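/- All graphs are finite and simple. A cut vertex of a connected graph $H$ is a vertex $v$ such that $H-v$ is disconnected. A block of a graph $G$ is a maximal connected subgraph of $G$ having no cut vertex (of its own), and a clique tree is a connected graph each of whose blocks is a complete graph. A set $S\subseteq V(G)$ is a zero forcing set if, starting with exactly the vertices of $S$ colored blue and the other vertices white, repeated application of the rule "if a blue vertex $u$ has exactly one white neighbor $v$, then color $v$ blue" can turn every vertex blue; the zero forcing number $Z(G)$ is the minimum size of a zero forcing set. Let $\rho(G)$ denote the spectral radius of the adjacency matrix of $G$. For $n,k\in\mathbb{N}$ let $G(n,k)$ be the class of clique trees $G$ on $n$ vertices with $Z(G)=k$ in which every block has at least $3$ vertices. Let $$\mathcal{G}(n,k)=K_{2k-n+2}\circledcirc K_3^{(n-k-1)}$$ be the graph consisting of one complete graph on $2k-n+2$ vertices and $n-k-1$ triangles, all of which contain one common vertex and are otherwise pairwise disjoint (for $k=n-1$ this is just $K_n$). **Theorem.** Suppose $G\in G(n,k)$. Then $\mathcal{G}(n,k)\in G(n,k)$, $$\rho(G)\le\rho(\mathcal{G}(n,k)),$$ and equality holds if and only if $G\cong\mathcal{G}(n,k)$. -/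

import Mathlib

namespace CliqueTree

universe u

/-- `v` is a cut vertex of `G`: the graph `G - v` is disconnected. (The empty graph does not count
as disconnected, so the vertex of `K₁` is not a cut vertex.) -/
def IsCutVertex {V : Type u} (G : SimpleGraph V) (v : V) : Prop :=
  ¬ (G.induce {w : V | w ≠ v}).Preconnected

/-- A block of `G`: a maximal connected subgraph of `G` that has no cut vertex of its own. -/
def IsBlock {V : Type u} (G : SimpleGraph V) (B : G.Subgraph) : Prop :=
  Maximal (fun H : G.Subgraph => H.Connected ∧ ∀ v, ¬ IsCutVertex H.coe v) B

/-- A clique tree: a connected graph each of whose blocks is a complete graph. -/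
def IsCliqueTree {V : Type u} (G : SimpleGraph V) : Prop :=
  G.Connected ∧ ∀ B : G.Subgraph, IsBlock G B → B.coe = ⊤

/-- One application of the color-change rule, where `B` and `B'` are the sets of blue vertices
before and after: some blue vertex `u` has exactly one white neighbour `v`, and `v` turns blue. -/
def ForceStep {V : Type u} (G : SimpleGraph V) (B B' : Set V) : Prop :=
  ∃ u ∈ B, ∃ v, G.neighborSet u \ B = {v} ∧ B' = insert v B

/-- `S` is a zero forcing set: repeated application of the color-change rule, starting with
exactly the vertices of `S` blue, can turn all vertices blue. -/
def IsZeroForcingSet {V : Type u} (G : SimpleGraph V) (S : Set V) : Prop :=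
  Relation.ReflTransGen (ForceStep G) S Set.univ

/-- The zero forcing number `Z(G)`: the smallest size of a zero forcing set. -/
noncomputable def zeroForcingNumber {V : Type u} [Fintype V] (G : SimpleGraph V) : ℕ :=
  sInf {m : ℕ | ∃ S : Finset V, IsZeroForcingSet G (S : Set V) ∧ S.card = m}

open Classical in
/-- The spectral radius `ρ(G)` of the adjacency matrix. The matrix is real symmetric, so all its
eigenvalues are real and the real spectrum is the whole spectrum. -/
noncomputable def rho {V : Type u} [Fintype V] (G : SimpleGraph V) : ENNReal :=
  spectralRadius ℝ (G.adjMatrix ℝ)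

/-- Membership in the class `G(n,k)`: clique trees on `n` vertices with zero forcing number `k`
in which every block has at least three vertices. -/
structure InClass {V : Type u} [Fintype V] (n k : ℕ) (G : SimpleGraph V) : Prop where
  card_eq : Fintype.card V = n
  cliqueTree : IsCliqueTree G
  three_le_block : ∀ B : G.Subgraph, IsBlock G B → 3 ≤ B.verts.ncard
  zeroForcing_eq : zeroForcingNumber G = k

/-- The vertices of a family of cliques, of sizes `s i`, glued along one common vertex: the common
vertex is `none`, and the `i`-th clique has `s i - 1` further vertices. -/
abbrev StarVertex {ι : Type} (s : ι → ℕ) : Type := Option (Σ i : ι, Fin (s i - 1))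

/-- The graph consisting of cliques of sizes `s i`, any two of which share exactly the common
vertex `none`: distinct vertices are adjacent iff one of them is the common vertex or both lie in
the same clique. -/
def cliqueStar {ι : Type} (s : ι → ℕ) : SimpleGraph (StarVertex s) where
  Adj x y := x ≠ y ∧ ∀ a ∈ x, ∀ b ∈ y, a.1 = b.1
  symm := ⟨fun _ _ h => ⟨h.1.symm, fun a ha b hb => (h.2 b hb a ha).symm⟩⟩
  loopless := ⟨fun _ h => h.1 rfl⟩

/-- The clique sizes of `K_{2k-n+2} ⊚ K_3^{(n-k-1)}`: one clique of size `2k-n+2` and `n-k-1`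
triangles. The differences are not truncated when `k + 1 ≤ n ≤ 2 * k + 2`. -/
def extremalSizes (n k : ℕ) : Option (Fin (n - k - 1)) → ℕ
  | none => 2 * k + 2 - n
  | some _ => 3

/-- The graph `K_{2k-n+2} ⊚ K_3^{(n-k-1)}`. -/
def extremalGraph (n k : ℕ) : SimpleGraph (StarVertex (extremalSizes n k)) :=
  cliqueStar (extremalSizes n k)

end CliqueTree

/-! Root the clique tree at a vertex `w` where the positive Perron vector `x` is largest. Every
other vertex is a non-root vertex of exactly one clique (`IsCliqueTree.exists_cliqueDecomp`). With m
cliques, Z(G) = n - m (`zeroForcingNumber_add_card`): each force completes a new clique, so at least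
n - m vertices start blue, and leaving one non-root vertex of each clique white suffices. Hence n
and k determine the number of cliques.

Let X_i be the sum of `x` over the non-root vertices of clique i. The quadratic form is the sum of
X_i² + 2 x(r_i) X_i over all cliques, minus the sum of x_v² over v ≠ w (`adjForm_eq`). Now attach
every clique at `w`, and move all but two non-root vertices of each clique into the heaviest clique.
The total of the X_i is unchanged, no root gets lighter, and the sum of X_i² does not decrease by
convexity, so neither does the form (`adjForm_le`). The new graph is a copy of the extremal graph on
the same vertices, and the Rayleigh bound gives the inequality.

In case of equality `x` is an eigenvector of both graphs for the same eigenvalue, so a neighbourhood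
inclusion at a vertex is an equality (`adj_of_eigenvector`). At `w` this shows that every clique
already had root `w`; at a non-root vertex of the heaviest clique it shows that no vertex was moved.
-/

namespace CliqueTree

universe u

open Finset

/-! ### Spectral radius, Rayleigh quotient and Perron vector -/

section Spectral

variable {V : Type*} [Fintype V]

open Classical in
/-- The quadratic form of the adjacency matrix. -/
noncomputable def adjForm (G : SimpleGraph V) (x : V → ℝ) : ℝ :=
  ∑ u, ∑ v, if G.Adj u v then x u * x v else 0

open Classical in
lemma dotProduct_adjMatrix_mulVec (G : SimpleGraph V) (x : V → ℝ) :
    x ⬝ᵥ (G.adjMatrix ℝ).mulVec x = adjForm G x := by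
  simp only [dotProduct, Matrix.mulVec, adjForm, SimpleGraph.adjMatrix_apply, mul_sum]
  refine sum_congr rfl fun u _ => sum_congr rfl fun v _ => ?_
  split_ifs <;> simp

open Classical in
lemma spectralRadius_eq_ofReal [Nonempty V] (A : Matrix V V ℝ) (hA : A.IsHermitian) :
    ∃ μ ∈ spectrum ℝ A, (∀ ν ∈ spectrum ℝ A, |ν| ≤ |μ|) ∧
      spectralRadius ℝ A = ENNReal.ofReal |μ| := by
  have hfin : (spectrum ℝ A).Finite := by
    rw [hA.spectrum_real_eq_range_eigenvalues]; exact Set.finite_range _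
  have hne : (spectrum ℝ A).Nonempty := by
    rw [hA.spectrum_real_eq_range_eigenvalues]; exact Set.range_nonempty _
  obtain ⟨μ, hμ, hmax⟩ := Set.exists_max_image _ (fun ν : ℝ => |ν|) hfin hne
  refine ⟨μ, hμ, hmax, ?_⟩
  have key : ∀ ν : ℝ, (‖ν‖₊ : ENNReal) = ENNReal.ofReal |ν| := fun ν => by
    rw [← Real.norm_eq_abs, ofReal_norm]; rfl
  refine le_antisymm (iSup₂_le fun ν hν => ?_) ?_
  · rw [key]; exact ENNReal.ofReal_le_ofReal (hmax ν hν)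
  · rw [← key]; exact le_iSup₂ (f := fun (k : ℝ) (_ : k ∈ spectrum ℝ A) => (‖k‖₊ : ENNReal)) μ hμ

open Classical in
/-- The spectral radius bounds the Rayleigh quotient, with equality only at eigenvectors, and it is
attained at a nonnegative nonzero vector. -/
lemma exists_rho_eq [Nonempty V] (G : SimpleGraph V) :
    ∃ s : ℝ, 0 ≤ s ∧ rho G = ENNReal.ofReal s ∧
      (∀ x : V → ℝ, adjForm G x ≤ s * ∑ v, x v ^ 2) ∧
      (∀ x : V → ℝ, adjForm G x = s * ∑ v, x v ^ 2 →
        ∀ u, ∑ v, (if G.Adj u v then x v else 0) = s * x u) ∧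
      ∃ x : V → ℝ, x ≠ 0 ∧ (∀ v, 0 ≤ x v) ∧ adjForm G x = s * ∑ v, x v ^ 2 := by
  set A := G.adjMatrix ℝ with hAdef
  have hA : A.IsHermitian := by
    rw [Matrix.IsHermitian, Matrix.conjTranspose_eq_transpose_of_trivial]
    exact G.isSymm_adjMatrix
  obtain ⟨μ, hμ, hmax, hrho⟩ := spectralRadius_eq_ofReal A hA
  -- No eigenvalue exceeds `|μ|`. Nonnegativity of this form is the Rayleigh bound, and its null
  -- vectors, which form the kernel, give the equality case.
  have hP : (algebraMap ℝ (Matrix V V ℝ) |μ| - A).PosSemidef := by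
    rw [Matrix.posSemidef_iff_isHermitian_and_spectrum_nonneg]
    refine ⟨?_, ?_⟩
    · refine Matrix.IsHermitian.sub ?_ hA
      rw [Algebra.algebraMap_eq_smul_one, Matrix.IsHermitian]
      simp
    · rw [← spectrum.singleton_sub_eq]
      rintro _ ⟨a, ha, ν, hν, rfl⟩
      rw [Set.mem_singleton_iff] at ha
      subst ha
      have := hmax ν hν
      have := le_abs_self ν
      simp only [Set.mem_ofPred_eq]
      linarith
  have hform : ∀ x : V → ℝ, x ⬝ᵥ ((algebraMap ℝ (Matrix V V ℝ) |μ| - A).mulVec x)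
      = |μ| * ∑ v, x v ^ 2 - adjForm G x := fun x => by
    rw [Matrix.sub_mulVec, dotProduct_sub, dotProduct_adjMatrix_mulVec,
      Algebra.algebraMap_eq_smul_one, Matrix.smul_mulVec, Matrix.one_mulVec, dotProduct_smul,
      smul_eq_mul]
    simp only [dotProduct, pow_two]
  have hle : ∀ x : V → ℝ, adjForm G x ≤ |μ| * ∑ v, x v ^ 2 := fun x => by
    have := hP.dotProduct_mulVec_nonneg x
    rw [star_trivial, hform] at this
    linarith
  refine ⟨|μ|, abs_nonneg _, hrho, hle, ?_, ?_⟩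
  · intro x hx u
    have h0 : star x ⬝ᵥ ((algebraMap ℝ (Matrix V V ℝ) |μ| - A).mulVec x) = 0 := by
      rw [star_trivial, hform, hx, sub_self]
    rw [hP.dotProduct_mulVec_zero_iff] at h0
    have h1 := congrFun h0 u
    rw [Matrix.sub_mulVec, Algebra.algebraMap_eq_smul_one, Matrix.smul_mulVec,
      Matrix.one_mulVec] at h1
    simp only [Pi.sub_apply, Pi.smul_apply, smul_eq_mul, Pi.zero_apply] at h1
    have h2 : A.mulVec x u = ∑ v, (if G.Adj u v then x v else 0) := by
      simp [hAdef, Matrix.mulVec, dotProduct, SimpleGraph.adjMatrix_apply]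
    rw [← h2]; linarith
  · rw [← Matrix.spectrum_toLin', ← Module.End.hasEigenvalue_iff_mem_spectrum] at hμ
    obtain ⟨y, hy⟩ := hμ.exists_hasEigenvector
    have hy1 : A.mulVec y = μ • y := by
      have := hy.apply_eq_smul
      rwa [Matrix.toLin'_apply] at this
    have hsq : ∀ v, |y v| ^ 2 = y v ^ 2 := fun v => sq_abs _
    -- Taking absolute values settles both signs of `μ`: by the triangle inequality the form at |y|
    -- is at least the absolute value of the form at y.
    refine ⟨fun v => |y v|, ?_, fun v => abs_nonneg _, le_antisymm (hle _) ?_⟩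
    · intro h
      apply hy.2
      funext v
      exact abs_eq_zero.1 (congrFun h v)
    · have h1 : adjForm G y = μ * ∑ v, y v ^ 2 := by
        rw [← dotProduct_adjMatrix_mulVec, ← hAdef, hy1, dotProduct_smul, smul_eq_mul]
        simp only [dotProduct, pow_two]
      simp only [hsq]
      rw [← abs_of_nonneg (sum_nonneg fun v _ => sq_nonneg (y v)), ← abs_mul, ← h1]
      unfold adjForm
      refine (abs_sum_le_sum_abs _ _).trans (sum_le_sum fun u _ => ?_)
      refine (abs_sum_le_sum_abs _ _).trans (sum_le_sum fun v _ => ?_)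
      split_ifs <;> simp [abs_mul]

open Classical in
/-- Perron–Frobenius for connected graphs. -/
lemma exists_pos_eigenvector (G : SimpleGraph V) (hG : G.Connected) :
    ∃ (s : ℝ) (x : V → ℝ), 0 ≤ s ∧ rho G = ENNReal.ofReal s ∧ (∀ v, 0 < x v) ∧
      adjForm G x = s * ∑ v, x v ^ 2 ∧
      ∀ u, ∑ v, (if G.Adj u v then x v else 0) = s * x u := by
  have := hG.nonempty
  obtain ⟨s, hs, hrho, -, heig, x, hx0, hx, hform⟩ := exists_rho_eq G
  have hex := heig x hform
  refine ⟨s, x, hs, hrho, ?_, hform, hex⟩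
  by_contra! h
  obtain ⟨u, hu⟩ := h
  -- At a zero of `x` the eigenvalue equation is a vanishing sum of nonnegative terms, so zeros
  -- spread along edges.
  have hstep : ∀ a b, G.Adj a b → x a = 0 → x b = 0 := by
    intro a b hab ha
    have h1 := hex a
    rw [ha, mul_zero, sum_eq_zero_iff_of_nonneg
      (fun v _ => by split_ifs <;> [exact hx v; exact le_rfl])] at h1
    simpa [hab] using h1 b (mem_univ _)
  apply hx0
  funext v
  obtain ⟨p⟩ := hG.preconnected u v
  have hu0 : x u = 0 := le_antisymm hu (hx u)
  clear hu
  induction p with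
  | nil => exact hu0
  | cons h p ih => exact ih (hstep _ _ h hu0)

open Classical in
lemma rho_iso {W : Type*} [Fintype W] {G : SimpleGraph V} {H : SimpleGraph W} (e : G ≃g H) :
    rho G = rho H := by
  unfold rho
  have : H.adjMatrix ℝ = Matrix.reindexAlgEquiv ℝ ℝ e.toEquiv (G.adjMatrix ℝ) := by
    ext a b
    simp only [Matrix.coe_reindexAlgEquiv, Matrix.reindex_apply, Matrix.submatrix_apply,
      SimpleGraph.adjMatrix_apply]
    congr 1
    exact propext e.symm.map_adj_iff.symm
  rw [this]
  unfold spectralRadius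
  rw [AlgEquiv.spectrum_eq]

open Classical in
/-- Two graphs with a common positive eigenvector and eigenvalue agree around a vertex as soon as
one neighbourhood is contained in the other. -/
lemma adj_of_eigenvector {G H : SimpleGraph V} {x : V → ℝ} {s : ℝ} (hx : ∀ v, 0 < x v) {u : V}
    (hG : ∑ v, (if G.Adj u v then x v else 0) = s * x u)
    (hH : ∑ v, (if H.Adj u v then x v else 0) = s * x u)
    (hle : ∀ v, G.Adj u v → H.Adj u v) {v : V} (hv : H.Adj u v) : G.Adj u v := by
  have h1 : ∀ v ∈ univ, (if G.Adj u v then x v else 0) ≤ (if H.Adj u v then x v else 0) := by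
    intro v _
    by_cases h : G.Adj u v
    · simp [h, hle v h]
    · simp only [h, if_false]; split_ifs <;> [exact (hx v).le; exact le_rfl]
  have h2 := (sum_eq_sum_iff_of_le h1).1 (hG.trans hH.symm) v (mem_univ _)
  by_contra h
  simp only [h, hv, if_true, if_false] at h2
  exact (hx v).ne h2

end Spectral

/-! ### Rooted clique decompositions: quadratic form and zero forcing number -/

/-- A decomposition of `G` into cliques arranged along a tree with root `w`: every vertex `v ≠ w`
belongs as a non-root vertex to exactly one clique `c v`, and the clique `i` has root `r i`, which
is closer to `w` than its other vertices. Every clique has at least two non-root vertices. The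
value of `c` at `w` is irrelevant. -/
structure CliqueDecomp {V ι : Type*} (G : SimpleGraph V) (w : V) (r : ι → V) (c : V → ι) :
    Prop where
  adj_iff : ∀ u v, G.Adj u v ↔ u ≠ v ∧
    ((u ≠ w ∧ v ≠ w ∧ c u = c v) ∨ (u ≠ w ∧ r (c u) = v) ∨ (v ≠ w ∧ r (c v) = u))
  depth : ∃ d : V → ℕ, ∀ v, v ≠ w → d (r (c v)) < d v
  two_le : ∀ i, ∃ u v, u ≠ v ∧ u ≠ w ∧ v ≠ w ∧ c u = i ∧ c v = i

namespace CliqueDecomp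

variable {V ι : Type*} {G : SimpleGraph V} {w : V} {r : ι → V} {c : V → ι}

open Classical in
/-- The total weight of the non-root vertices of a clique. -/
noncomputable def weight [Fintype V] (w : V) (c : V → ι) (x : V → ℝ) (i : ι) : ℝ :=
  ∑ v with c v = i, if v ≠ w then x v else 0

lemma weight_nonneg [Fintype V] {x : V → ℝ} (hx : ∀ v, 0 ≤ x v) (i : ι) :
    0 ≤ weight w c x i :=
  sum_nonneg fun v _ => by split_ifs <;> [exact hx v; exact le_rfl]

open Classical in
lemma sum_mul_weight [Fintype V] [Fintype ι] (x : V → ℝ) (f : ι → ℝ) :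
    ∑ i, f i * weight w c x i = ∑ v, f (c v) * if v ≠ w then x v else 0 := by
  rw [← sum_fiberwise (s := univ) (g := c)]
  refine sum_congr rfl fun i _ => ?_
  rw [weight, mul_sum]
  refine sum_congr rfl fun v hv => ?_
  rw [(mem_filter.1 hv).2]

open Classical in
lemma sum_weight [Fintype V] [Fintype ι] (x : V → ℝ) :
    ∑ i, weight w c x i = ∑ v, if v ≠ w then x v else 0 := by
  simpa using sum_mul_weight (w := w) (c := c) x (fun _ => 1)

open Classical in
lemma adjForm_eq [Fintype V] [Fintype ι] (h : CliqueDecomp G w r c) (x : V → ℝ) :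
    adjForm G x = ∑ i, weight w c x i ^ 2 + 2 * ∑ i, x (r i) * weight w c x i
      - ∑ v, if v ≠ w then x v ^ 2 else 0 := by
  obtain ⟨d, hd⟩ := h.depth
  set y : V → ℝ := fun v => if v ≠ w then x v else 0 with hy
  -- The terms are: both vertices non-root in one clique, `v` the root of the clique of `u`, the
  -- reverse, and a correction for the diagonal pairs counted by the first. The depth function keeps
  -- the first three from overlapping.
  have hpt : ∀ u v, (if G.Adj u v then x u * x v else 0) =
      (if c v = c u then y u * y v else 0) + (if v = r (c u) then y u * x v else 0)
      + (if u = r (c v) then x u * y v else 0) - (if u = v then y u * y v else 0) := by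
    intro u v
    have h1 := hd u
    have h2 := hd v
    simp only [h.adj_iff, hy]
    by_cases huv : u = v
    · subst huv
      by_cases hu : u = w
      · simp [hu]
      · have : u ≠ r (c u) := fun e => by have := h1 hu; rw [← e] at this; omega
        simp [this]
    by_cases hu : u = w
    · by_cases hv : v = w
      · exact absurd (hu.trans hv.symm) huv
      · simp only [hu, hv, eq_comm (a := w)]
        have : w ≠ v := fun e => hv e.symm
        simp [this, hv]
    · by_cases hv : v = w
      · simp only [hv, eq_comm (a := w)]
        simp [hu]
      · by_cases hc : c v = c u
        · have h3 : v ≠ r (c u) := fun e => by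
            have := h2 hv; rw [hc, ← e] at this; omega
          have h4 : u ≠ r (c v) := fun e => by
            have := h1 hu; rw [← hc, ← e] at this; omega
          simp [hu, hv, huv, hc, h3, hc ▸ h4]
        · have hc' : ¬ c u = c v := fun e => hc e.symm
          by_cases h3 : v = r (c u)
          · have h4 : u ≠ r (c v) := fun e => by
              have := h1 hu; have h5 := h2 hv; rw [← h3] at this; rw [← e] at h5; omega
            simp only [hc, h4, h4.symm, h3.symm, hc']
            simp [huv, hu]
          · have h3' : ¬ r (c u) = v := fun e => h3 e.symm
            simp only [hc, h3, h3', hc', eq_comm (a := u) (b := r (c v))]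
            simp [huv, hv]
  unfold adjForm
  simp only [hpt, sum_add_distrib, sum_sub_distrib]
  have e1 : ∑ u, ∑ v, (if c v = c u then y u * y v else 0) = ∑ i, weight w c x i ^ 2 := by
    simp only [pow_two]
    rw [sum_mul_weight]
    refine sum_congr rfl fun u _ => ?_
    rw [weight, sum_filter, sum_mul]
    refine sum_congr rfl fun v _ => ?_
    split_ifs <;> simp_all [mul_comm]
  have e2 : ∑ u, ∑ v, (if v = r (c u) then y u * x v else 0)
      = ∑ i, x (r i) * weight w c x i := by
    rw [sum_mul_weight x (fun i => x (r i))]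
    refine sum_congr rfl fun u _ => ?_
    rw [sum_ite_eq' univ (r (c u)) (fun v => y u * x v)]
    simp [hy, mul_comm]
  have e3 : ∑ u, ∑ v, (if u = r (c v) then x u * y v else 0)
      = ∑ i, x (r i) * weight w c x i := by
    rw [sum_comm, ← e2]
    simp only [mul_comm]
  have e4 : ∑ u, ∑ v, (if u = v then y u * y v else 0) = ∑ v, if v ≠ w then x v ^ 2 else 0 := by
    refine sum_congr rfl fun u _ => ?_
    rw [sum_ite_eq univ u (fun v => y u * y v)]
    simp only [hy, mem_univ, if_true]
    split_ifs <;> simp [pow_two]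
  rw [e1, e2, e3, e4]
  ring

/-- Merging parts of all cliques into the heaviest one, and attaching all cliques to the heaviest
vertex, does not decrease the quadratic form. -/
lemma adjForm_le [Fintype V] [Fintype ι] {τ : Type*} [Fintype τ] {G' : SimpleGraph V}
    {c' : V → Option τ} {i₀ : ι} (h : CliqueDecomp G w r c)
    (h' : CliqueDecomp G' w (fun _ => w) c') (e : τ ≃ {i : ι // i ≠ i₀})
    (hc : ∀ v, v ≠ w → ∀ j, c' v = some j → c v = e j) {x : V → ℝ} (hx : ∀ v, 0 ≤ x v)
    (hw : ∀ v, x v ≤ x w) (hi : ∀ i, weight w c x i ≤ weight w c x i₀) :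
    adjForm G x ≤ adjForm G' x := by
  classical
  rw [h.adjForm_eq, h'.adjForm_eq]
  have hle : ∀ j, weight w c' x (some j) ≤ weight w c x (e j) := by
    intro j
    unfold weight
    rw [sum_filter, sum_filter]
    refine sum_le_sum fun v _ => ?_
    have := hx v
    by_cases hv : v = w
    · simp [hv]
    · by_cases hj : c' v = some j
      · simp [hj, hc v hv j hj]
      · simp only [hj, if_false]; split_ifs <;> simp_all
  have hsplit : ∀ f : ι → ℝ, ∑ i, f i = f i₀ + ∑ j, f (e j) := by
    intro f
    rw [Fintype.sum_eq_add_sum_subtype_ne f i₀, e.sum_comp (fun i => f i)]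
  have htot : ∑ i, weight w c x i = ∑ j, weight w c' x j := by
    rw [sum_weight, sum_weight]
  have hroot : ∑ i, x (r i) * weight w c x i ≤ ∑ j, x w * weight w c' x j := by
    rw [← mul_sum, ← htot, mul_sum]
    exact sum_le_sum fun i _ => mul_le_mul_of_nonneg_right (hw _) (weight_nonneg hx i)
  have hsq : ∑ i, weight w c x i ^ 2 ≤ ∑ j, weight w c' x j ^ 2 := by
    rw [hsplit, Fintype.sum_option] at htot ⊢
    set X := weight w c x
    set Y := weight w c' x
    set M := ∑ j, (X (e j) - Y (some j)) with hM
    have hM0 : 0 ≤ M := sum_nonneg fun j _ => sub_nonneg.2 (hle j)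
    -- The total weight is conserved, so the heaviest clique gains exactly the weight `M` lost by
    -- the others.
    have hY : Y none = X i₀ + M := by rw [hM, sum_sub_distrib]; linarith
    -- X² - Y² = (X - Y)(X + Y) ≤ 2 (X - Y) X(i₀), as Y ≤ X ≤ X(i₀). The loss is thus covered by the
    -- cross term of (X(i₀) + M)².
    have h1 : ∑ j, X (e j) ^ 2 ≤ ∑ j, Y (some j) ^ 2 + 2 * X i₀ * M := by
      rw [hM, mul_sum, ← sum_add_distrib]
      refine sum_le_sum fun j _ => ?_
      have := hle j
      have := hi (e j)
      nlinarith [sq_nonneg (X (e j) - Y (some j)),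
        mul_nonneg (sub_nonneg.2 (hle j)) (sub_nonneg.2 (hi (e j)))]
    rw [hY]
    nlinarith [sq_nonneg M]
  linarith

/-- The vertex set of a clique of the decomposition. -/
def clique (w : V) (r : ι → V) (c : V → ι) (i : ι) : Set V := {v | v = r i ∨ (v ≠ w ∧ c v = i)}

lemma adj_iff_clique (h : CliqueDecomp G w r c) {u v : V} :
    G.Adj u v ↔ u ≠ v ∧ ∃ i, u ∈ clique w r c i ∧ v ∈ clique w r c i := by
  rw [h.adj_iff]
  refine and_congr_right fun huv => ⟨?_, ?_⟩
  · rintro (⟨hu, hv, e⟩ | ⟨hu, e⟩ | ⟨hv, e⟩)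
    · exact ⟨c u, Or.inr ⟨hu, rfl⟩, Or.inr ⟨hv, e.symm⟩⟩
    · exact ⟨c u, Or.inr ⟨hu, rfl⟩, Or.inl e.symm⟩
    · exact ⟨c v, Or.inl e.symm, Or.inr ⟨hv, rfl⟩⟩
  · rintro ⟨i, hu | ⟨hu, rfl⟩, hv | ⟨hv, hi⟩⟩
    · exact absurd (hu.trans hv.symm) huv
    · exact Or.inr (Or.inr ⟨hv, hi ▸ hu.symm⟩)
    · exact Or.inr (Or.inl ⟨hu, hv.symm⟩)
    · exact Or.inl ⟨hu, hv, hi.symm⟩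

/-- Every force fills a further clique. -/
lemma ncard_le_of_force [Finite V] [Finite ι] (h : CliqueDecomp G w r c) {S B : Set V}
    (hB : Relation.ReflTransGen (ForceStep G) S B) :
    B.ncard ≤ S.ncard + {i | clique w r c i ⊆ B}.ncard := by
  induction hB with
  | refl => omega
  | @tail B B' _ hstep ih =>
    obtain ⟨u, hu, v, hv, rfl⟩ := hstep
    have hv1 : v ∈ G.neighborSet u \ B := by rw [hv]; rfl
    obtain ⟨huv, i, hui, hvi⟩ := h.adj_iff_clique.1 hv1.1
    -- The clique containing `u` and `v` becomes full: its other vertices are neighbours of `u`, and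
    -- `v` was the only white one.
    have hlt : {i | clique w r c i ⊆ B}.ncard < {i | clique w r c i ⊆ insert v B}.ncard := by
      refine Set.ncard_lt_ncard ⟨fun j hj => ?_, fun hsub => ?_⟩ (Set.toFinite _)
      · exact Set.Subset.trans hj (Set.subset_insert _ _)
      · refine hv1.2 (hsub (a := i) (fun x hx => ?_) hvi)
        by_cases hxB : x ∈ B
        · exact Or.inr hxB
        by_cases hxu : u = x
        · exact absurd (hxu ▸ hu) hxB
        · have : x ∈ G.neighborSet u \ B := ⟨h.adj_iff_clique.2 ⟨hxu, i, hui, hx⟩, hxB⟩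
          rw [hv] at this
          exact Or.inl this
    have := Set.ncard_insert_of_notMem hv1.2
    omega

lemma card_le_of_isZeroForcingSet [Fintype V] [Fintype ι] (h : CliqueDecomp G w r c)
    {S : Finset V} (hS : IsZeroForcingSet G (S : Set V)) :
    Fintype.card V ≤ S.card + Fintype.card ι := by
  have h1 := h.ncard_le_of_force hS
  rw [Set.ncard_univ, Nat.card_eq_fintype_card, Set.ncard_coe_finset] at h1
  have h2 : {i | clique w r c i ⊆ Set.univ}.ncard ≤ Nat.card ι := by
    rw [← Set.ncard_univ]; exact Set.ncard_le_ncard (Set.subset_univ _) (Set.toFinite _)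
  rw [Nat.card_eq_fintype_card] at h2
  omega

/-- Two non-root vertices from each clique, together with `w`, are all distinct. -/
lemma card_add_card_le [Fintype V] [Fintype ι] (h : CliqueDecomp G w r c) :
    2 * Fintype.card ι + 1 ≤ Fintype.card V := by
  choose p q hpq hp hq hcp hcq using h.two_le
  let f : Option (ι ⊕ ι) → V := fun o => o.elim w (Sum.elim p q)
  have hf : Function.Injective f := by
    rintro (_ | i | i) (_ | j | j) hij
    · rfl
    · exact absurd hij.symm (hp j)
    · exact absurd hij.symm (hq j)
    · exact absurd hij (hp i)
    · have := congrArg c hij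
      simp only [f, Option.elim, Sum.elim_inl, hcp] at this
      rw [this]
    · have := congrArg c hij
      simp only [f, Option.elim, Sum.elim_inl, Sum.elim_inr, hcp, hcq] at this
      subst this; exact absurd hij (hpq _)
    · exact absurd hij (hq i)
    · have := congrArg c hij
      simp only [f, Option.elim, Sum.elim_inl, Sum.elim_inr, hcp, hcq] at this
      subst this; exact absurd hij.symm (hpq _)
    · have := congrArg c hij
      simp only [f, Option.elim, Sum.elim_inr, hcq] at this
      rw [this]
  have := Fintype.card_le_of_injective f hf
  simp only [Fintype.card_option, Fintype.card_sum] at this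
  omega

/-- A set that misses one non-root vertex of each clique is a zero forcing set. -/
lemma isZeroForcingSet_compl_range [Finite V] (h : CliqueDecomp G w r c) {q : ι → V}
    (hq : ∀ i, q i ≠ w) (hcq : ∀ i, c (q i) = i) :
    IsZeroForcingSet G (Set.range q)ᶜ := by
  obtain ⟨d, hd⟩ := h.depth
  -- A reachable blue set of maximal size admits no further force; if it were not everything, a
  -- force would still be possible.
  obtain ⟨B, hB, hmax⟩ := Set.exists_max_image
    {B | Relation.ReflTransGen (ForceStep G) (Set.range q)ᶜ B} Set.ncard (Set.toFinite _)
    ⟨_, Relation.ReflTransGen.refl⟩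
  have hSB : (Set.range q)ᶜ ⊆ B := by
    have : ∀ C, Relation.ReflTransGen (ForceStep G) (Set.range q)ᶜ C → (Set.range q)ᶜ ⊆ C := by
      intro C hC
      induction hC with
      | refl => exact subset_rfl
      | tail _ hs ih =>
        obtain ⟨u, _, v, _, rfl⟩ := hs
        exact ih.trans (Set.subset_insert _ _)
    exact this B hB
  have hstuck : ∀ B', ¬ ForceStep G B B' := by
    intro B' hs
    have h1 := hmax B' (hB.tail hs)
    obtain ⟨u, hu, v, hv, rfl⟩ := hs
    have hv1 : v ∈ G.neighborSet u \ B := by rw [hv]; rfl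
    have := Set.ncard_insert_of_notMem hv1.2
    omega
  suffices B = Set.univ by rw [IsZeroForcingSet, ← this]; exact hB
  by_contra hne
  have hwhite : ∀ v, v ∉ B → ∃ i, q i = v := fun v hv => by
    by_contra hcon
    exact hv (hSB hcon)
  let T : Set V := {v | v ∉ B ∧ r (c v) ∈ B}
  have hT : T.Nonempty := by
    obtain ⟨v, hv, hmin⟩ := Set.exists_min_image Bᶜ d (Set.toFinite _) (by
      rw [Set.nonempty_compl]; exact hne)
    refine ⟨v, hv, ?_⟩
    by_contra hr
    obtain ⟨i, rfl⟩ := hwhite v hv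
    exact absurd (hd _ (hq i)) (not_lt.2 (hmin _ hr))
  -- Among white vertices whose clique root is blue, one with the deepest root is taken. A second
  -- non-root vertex `a` of its clique is blue and can force it: a white vertex in a clique rooted
  -- at `a` would have a deeper blue root.
  obtain ⟨v, ⟨hvB, hrB⟩, hmax⟩ := Set.exists_max_image T (fun v => d (r (c v))) (Set.toFinite _) hT
  obtain ⟨i, rfl⟩ := hwhite v hvB
  rw [hcq] at hrB
  simp only [hcq] at hmax
  obtain ⟨a, ha1, ha2, ha3⟩ : ∃ a, a ≠ q i ∧ a ≠ w ∧ c a = i := by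
    obtain ⟨a, b, hab, ha, hb, hca, hcb⟩ := h.two_le i
    by_cases e : a = q i
    · exact ⟨b, fun e' => hab (e.trans e'.symm), hb, hcb⟩
    · exact ⟨a, e, ha, hca⟩
  have haB : a ∈ B := by
    by_contra hcon
    obtain ⟨j, rfl⟩ := hwhite a hcon
    rw [hcq] at ha3
    exact ha1 (by rw [ha3])
  refine hstuck _ ⟨a, haB, q i, ?_, rfl⟩
  ext x
  simp only [Set.mem_sdiff, SimpleGraph.mem_neighborSet, Set.mem_singleton_iff]
  constructor
  · rintro ⟨hadj, hx⟩
    obtain ⟨j, rfl⟩ := hwhite x hx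
    obtain ⟨hne', h1⟩ := (h.adj_iff _ _).1 hadj
    rw [ha3, hcq] at h1
    rcases h1 with ⟨-, -, e⟩ | ⟨-, e⟩ | ⟨-, e⟩
    · rw [e]
    · exact absurd (e ▸ hrB) hx
    · have h2 := hmax (q j) ⟨hx, by rw [hcq, e]; exact haB⟩
      simp only [hcq] at h2
      have h3 := hd a ha2
      rw [ha3] at h3
      rw [e] at h2
      omega
  · rintro rfl
    exact ⟨(h.adj_iff _ _).2 ⟨ha1, Or.inl ⟨ha2, hq i, by rw [ha3, hcq]⟩⟩, hvB⟩

lemma zeroForcingNumber_add_card [Fintype V] [Fintype ι] (h : CliqueDecomp G w r c) :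
    zeroForcingNumber G + Fintype.card ι = Fintype.card V := by
  classical
  choose p q hpq hp hq hcp hcq using h.two_le
  have hinj : Function.Injective q := fun i j e => by rw [← hcq i, ← hcq j, e]
  have hmem : Fintype.card V - Fintype.card ι ∈
      {m : ℕ | ∃ S : Finset V, IsZeroForcingSet G (S : Set V) ∧ S.card = m} := by
    refine ⟨(univ.image q)ᶜ, ?_, ?_⟩
    · have := h.isZeroForcingSet_compl_range hq hcq
      simpa using this
    · rw [card_compl, card_image_of_injective _ hinj, card_univ]
  have hcard := h.card_add_card_le
  have h1 := Nat.sInf_le hmem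
  obtain ⟨S, hS, hS'⟩ := Nat.sInf_mem ⟨_, hmem⟩
  have h2 := h.card_le_of_isZeroForcingSet hS
  change zeroForcingNumber G ≤ _ at h1
  change S.card = zeroForcingNumber G at hS'
  omega

end CliqueDecomp

/-! ### Blocks of clique trees -/

section Blocks

variable {V : Type*} {G : SimpleGraph V}

/-- The subgraphs among which the blocks are the maximal ones. -/
def HasNoCut (H : G.Subgraph) : Prop := H.Connected ∧ ∀ v, ¬ IsCutVertex H.coe v

lemma reachable_coe_induce {H : G.Subgraph} {t : H.verts} {a b : V} (p : G.Walk a b)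
    (hH : ∀ x ∈ H.verts, ∀ y ∈ H.verts, G.Adj x y → H.Adj x y)
    (hp : ∀ x ∈ p.support, ∃ hx : x ∈ H.verts, (⟨x, hx⟩ : H.verts) ≠ t) :
    (H.coe.induce {w : H.verts | w ≠ t}).Reachable
      ⟨⟨a, (hp a p.start_mem_support).1⟩, (hp a p.start_mem_support).2⟩
      ⟨⟨b, (hp b p.end_mem_support).1⟩, (hp b p.end_mem_support).2⟩ := by
  induction p with
  | nil => exact SimpleGraph.Reachable.refl _
  | @cons a c b hac p ih =>
    have hp' : ∀ x ∈ p.support, ∃ hx : x ∈ H.verts, (⟨x, hx⟩ : H.verts) ≠ t :=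
      fun x hx => hp x (by simp [hx])
    refine SimpleGraph.Reachable.trans (SimpleGraph.Adj.reachable ?_) (ih hp')
    exact hH _ (hp a (by simp)).1 _ (hp' c p.start_mem_support).1 hac

/-- It is enough to join everything to one hub, which may depend on the deleted vertex `t`. If `t`
is the only vertex of `s`, the hub is arbitrary. -/
lemma hasNoCut_induce {s : Set V} {h₀ : V}
    (hs : ∀ x ∈ s, ∃ p : G.Walk x h₀, ∀ y ∈ p.support, y ∈ s) (hh₀ : h₀ ∈ s)
    (hcut : ∀ t ∈ s, ∃ h, ∀ x ∈ s, x ≠ t → ∃ p : G.Walk x h, ∀ y ∈ p.support, y ∈ s ∧ y ≠ t) :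
    HasNoCut ((⊤ : G.Subgraph).induce s) := by
  have hadj : ∀ x ∈ ((⊤ : G.Subgraph).induce s).verts,
      ∀ y ∈ ((⊤ : G.Subgraph).induce s).verts, G.Adj x y →
        ((⊤ : G.Subgraph).induce s).Adj x y :=
    fun x hx y hy h => ⟨hx, hy, h⟩
  refine ⟨SimpleGraph.Subgraph.connected_iff.2
    ⟨(SimpleGraph.Subgraph.preconnected_iff_forall_exists_walk_subgraph _).2 ?_,
    ⟨h₀, hh₀⟩⟩, ?_⟩
  · intro a b ha hb
    obtain ⟨p, hp⟩ := hs a ha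
    obtain ⟨q, hq⟩ := hs b hb
    refine ⟨p.append q.reverse, ?_⟩
    refine (SimpleGraph.Walk.toSubgraph_le_induce_support _).trans
      (SimpleGraph.Subgraph.induce_mono_right fun x hx => ?_)
    rcases (SimpleGraph.Walk.mem_support_append_iff _ _).1 hx with h | h
    · exact hp x h
    · exact hq x (by simpa using h)
  · rintro ⟨t, ht⟩ hc
    apply hc
    obtain ⟨h, hh⟩ := hcut t ht
    rintro ⟨⟨a, ha⟩, hat⟩ ⟨⟨b, hb⟩, hbt⟩
    obtain ⟨p, hp⟩ := hh a ha (fun e => hat (Subtype.ext e))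
    obtain ⟨q, hq⟩ := hh b hb (fun e => hbt (Subtype.ext e))
    refine (reachable_coe_induce (t := ⟨t, ht⟩) p hadj fun x hx =>
      ⟨(hp x hx).1, fun e => (hp x hx).2 (congrArg Subtype.val e)⟩).trans
      (reachable_coe_induce (t := ⟨t, ht⟩) q hadj fun x hx =>
      ⟨(hq x hx).1, fun e => (hq x hx).2 (congrArg Subtype.val e)⟩).symm

lemma hasNoCut_induce_of_clique {s : Set V} (hs : s.Nonempty)
    (hcl : ∀ a ∈ s, ∀ b ∈ s, a ≠ b → G.Adj a b) :
    HasNoCut ((⊤ : G.Subgraph).induce s) := by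
  have hw : ∀ a ∈ s, ∀ b ∈ s, ∃ p : G.Walk a b, ∀ y ∈ p.support, y = a ∨ y = b := by
    intro a ha b hb
    by_cases hab : a = b
    · subst hab; exact ⟨.nil, by simp⟩
    · exact ⟨(hcl a ha b hb hab).toWalk, by simp⟩
  obtain ⟨h₀, hh₀⟩ := hs
  refine hasNoCut_induce (h₀ := h₀) (fun x hx => ?_) hh₀ (fun t _ => ?_)
  · obtain ⟨p, hp⟩ := hw x hx h₀ hh₀
    exact ⟨p, fun y hy => by rcases hp y hy with rfl | rfl <;> assumption⟩
  · by_cases h : ∃ h ∈ s, h ≠ t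
    · obtain ⟨h, hh, hht⟩ := h
      refine ⟨h, fun x hx hxt => ?_⟩
      obtain ⟨p, hp⟩ := hw x hx h hh
      exact ⟨p, fun y hy => by rcases hp y hy with rfl | rfl <;> constructor <;> assumption⟩
    · push Not at h
      exact ⟨h₀, fun x hx hxt => absurd (h x hx) hxt⟩

/-- A vertex together with a path between two of its neighbours spans no cut vertex. -/
lemma hasNoCut_induce_cycle {v a b : V} (ha : G.Adj v a) (hb : G.Adj v b) (q : G.Walk a b)
    (hq : q.IsPath) (hv : v ∉ q.support) :
    HasNoCut ((⊤ : G.Subgraph).induce (insert v {x | x ∈ q.support})) := by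
  classical
  have hstart : ∀ x (hx : x ∈ q.support), ∀ y ∈ (q.takeUntil x hx).reverse.support,
      y ∈ q.support := by
    intro x hx y hy
    rw [SimpleGraph.Walk.support_reverse, List.mem_reverse] at hy
    exact q.support_takeUntil_subset_support hx hy
  refine hasNoCut_induce (h₀ := v) (fun x hx => ?_) (Or.inl rfl) (fun t ht => ?_)
  · rcases hx with rfl | hx
    · exact ⟨.nil, by simp⟩
    · refine ⟨(q.takeUntil x hx).reverse.concat ha.symm, fun y hy => ?_⟩
      rw [SimpleGraph.Walk.support_concat, List.mem_append,
        List.mem_singleton] at hy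
      rcases hy with hy | rfl
      · exact Or.inr (hstart x hx y hy)
      · exact Or.inl rfl
  · by_cases htv : t = v
    · subst htv
      refine ⟨a, fun x hx hxt => ?_⟩
      rcases hx with rfl | hx
      · exact absurd rfl hxt
      · exact ⟨(q.takeUntil x hx).reverse, fun y hy =>
          ⟨Or.inr (hstart x hx y hy), fun e => hv (e ▸ hstart x hx y hy)⟩⟩
    · refine ⟨v, fun x hx hxt => ?_⟩
      rcases hx with rfl | hx
      · exact ⟨.nil, by simpa using fun e => htv e.symm⟩
      -- Deleting `t` leaves one of the two arcs from `x` to `v` intact: if `t` comes before `x` on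
      -- the path, the arc through `b` survives, otherwise the one through `a`.
      · by_cases h1 : t ∈ (q.takeUntil x hx).support
        · have h2 : t ∉ (q.dropUntil x hx).support := by
            intro h2
            rw [← SimpleGraph.Walk.cons_tail_support, List.mem_cons] at h2
            rcases h2 with h2 | h2
            · exact hxt h2.symm
            · have hq' := hq
              rw [← q.take_spec hx, SimpleGraph.Walk.isPath_def,
                SimpleGraph.Walk.support_append] at hq'
              exact List.disjoint_of_nodup_append hq' h1
                h2
          refine ⟨(q.dropUntil x hx).concat hb.symm, fun y hy => ?_⟩
          rw [SimpleGraph.Walk.support_concat, List.mem_append,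
            List.mem_singleton] at hy
          rcases hy with hy | rfl
          · exact ⟨Or.inr (q.support_dropUntil_subset_support hx hy), fun e => h2 (e ▸ hy)⟩
          · exact ⟨Or.inl rfl, fun e => htv e.symm⟩
        · refine ⟨(q.takeUntil x hx).reverse.concat ha.symm, fun y hy => ?_⟩
          rw [SimpleGraph.Walk.support_concat, List.mem_append,
            List.mem_singleton] at hy
          rcases hy with hy | rfl
          · refine ⟨Or.inr (hstart x hx y hy), fun e => h1 ?_⟩
            rw [SimpleGraph.Walk.support_reverse, List.mem_reverse] at hy
            exact e ▸ hy
          · exact ⟨Or.inl rfl, fun e => htv e.symm⟩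

lemma exists_block [Finite V] {H : G.Subgraph} (hH : HasNoCut H) : ∃ B, H ≤ B ∧ IsBlock G B := by
  have := Fintype.ofFinite V
  exact Finite.exists_le_maximal (p := fun H : G.Subgraph => HasNoCut H) hH

lemma IsCliqueTree.adj_of_mem_block (hG : IsCliqueTree G) {B : G.Subgraph} (hB : IsBlock G B)
    {a b : V} (ha : a ∈ B.verts) (hb : b ∈ B.verts) (hab : a ≠ b) : G.Adj a b := by
  have h1 : B.coe.Adj ⟨a, ha⟩ ⟨b, hb⟩ := by
    rw [hG.2 B hB]
    exact fun e => hab (congrArg Subtype.val e)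
  exact B.adj_sub h1

/-- In a clique tree, two neighbours of `v` connected in `G - v` are adjacent. -/
lemma IsCliqueTree.adj_of_walk [Finite V] (hG : IsCliqueTree G) {v a b : V} (ha : G.Adj v a)
    (hb : G.Adj v b) (p : G.Walk a b) (hv : v ∉ p.support) (hab : a ≠ b) : G.Adj a b := by
  classical
  obtain ⟨B, hle, hB⟩ := exists_block (hasNoCut_induce_cycle ha hb p.bypass p.bypass_isPath
    (fun h => hv (p.support_bypass_subset_support h)))
  exact hG.adj_of_mem_block hB (hle.1 (Or.inr p.bypass.start_mem_support))
    (hle.1 (Or.inr p.bypass.end_mem_support)) hab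

/-- The edge has no cut vertex, so it lies in a block, which is complete and has a third vertex. -/
lemma IsCliqueTree.exists_triangle [Finite V] (hG : IsCliqueTree G)
    (h3 : ∀ B : G.Subgraph, IsBlock G B → 3 ≤ B.verts.ncard) {u v : V} (huv : G.Adj u v) :
    ∃ x, G.Adj u x ∧ G.Adj v x := by
  obtain ⟨B, hle, hB⟩ := exists_block (hasNoCut_induce_of_clique (G := G) (s := {u, v}) ⟨u, by simp⟩
    (by
      rintro a (rfl | rfl) b (rfl | rfl) hab <;>
        [exact absurd rfl hab; exact huv; exact huv.symm; exact absurd rfl hab]))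
  have hu : u ∈ B.verts := hle.1 (by simp)
  have hv : v ∈ B.verts := hle.1 (by simp)
  have hcard : ({u, v} : Set V).ncard < B.verts.ncard := by
    have := Set.ncard_pair huv.ne
    have := h3 B hB
    omega
  obtain ⟨x, hx, hx'⟩ := Set.exists_mem_notMem_of_ncard_lt_ncard hcard
  simp only [Set.mem_insert_iff, Set.mem_singleton_iff, not_or] at hx'
  exact ⟨x, hG.adj_of_mem_block hB hu hx (Ne.symm hx'.1),
    hG.adj_of_mem_block hB hv hx (Ne.symm hx'.2)⟩

lemma IsCliqueTree.three_le_card [Fintype V] (hG : IsCliqueTree G)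
    (h3 : ∀ B : G.Subgraph, IsBlock G B → 3 ≤ B.verts.ncard) : 3 ≤ Fintype.card V := by
  obtain ⟨v⟩ := hG.1.nonempty
  obtain ⟨B, -, hB⟩ := exists_block (hasNoCut_induce_of_clique (G := G) (s := {v}) ⟨v, rfl⟩
    (by rintro a rfl b rfl hab; exact absurd rfl hab))
  refine (h3 B hB).trans ?_
  rw [← Nat.card_eq_fintype_card, ← Set.ncard_univ]
  exact Set.ncard_le_ncard (Set.subset_univ _) (Set.toFinite _)

/-! ### Distance layers from a root -/

section Rooted

variable (w : V)

lemma dist_le_of_adj (hG : G.Connected) {u v : V} (h : G.Adj u v) :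
    G.dist w v ≤ G.dist w u + 1 := by
  have := hG.dist_triangle (u := w) (v := u) (w := v)
  rwa [SimpleGraph.dist_eq_one_iff_adj.2 h] at this

lemma exists_parent (hG : G.Connected) {v : V} (hv : v ≠ w) :
    ∃ u, G.Adj v u ∧ G.dist w u + 1 = G.dist w v := by
  obtain ⟨p, hp⟩ := hG.exists_walk_length_eq_dist v w
  cases p with
  | nil => exact absurd rfl hv
  | @cons _ u _ h p =>
    refine ⟨u, h, ?_⟩
    have h1 := SimpleGraph.dist_le p
    have h2 := dist_le_of_adj w hG h.symm
    rw [SimpleGraph.Walk.length_cons] at hp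
    rw [SimpleGraph.dist_comm] at h1 hp
    omega

lemma exists_walk_to_root (hG : G.Connected) (v : V) :
    ∃ p : G.Walk v w, ∀ x ∈ p.support, x = v ∨ G.dist w x < G.dist w v := by
  induction hn : G.dist w v using Nat.strong_induction_on generalizing v with
  | _ n ih =>
    by_cases hv : v = w
    · subst hv; exact ⟨.nil, by simp⟩
    · obtain ⟨u, hu, hd⟩ := exists_parent w hG hv
      obtain ⟨p, hp⟩ := ih _ (by omega) u rfl
      refine ⟨.cons hu p, fun x hx => ?_⟩
      rw [SimpleGraph.Walk.support_cons, List.mem_cons] at hx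
      rcases hx with rfl | hx
      · exact Or.inl rfl
      · rcases hp x hx with rfl | h <;> right <;> omega

/-- Geodesics to the root descend strictly, so starting no deeper than `v` and away from it they
miss `v`; they are joined at `w`. -/
lemma exists_walk_avoiding (hG : G.Connected) {v a b : V} (hav : a ≠ v) (hbv : b ≠ v)
    (ha : G.dist w a ≤ G.dist w v) (hb : G.dist w b ≤ G.dist w v) :
    ∃ p : G.Walk a b, v ∉ p.support := by
  obtain ⟨p, hp⟩ := exists_walk_to_root w hG a
  obtain ⟨q, hq⟩ := exists_walk_to_root w hG b
  refine ⟨p.append q.reverse, fun h => ?_⟩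
  rw [SimpleGraph.Walk.mem_support_append_iff, SimpleGraph.Walk.support_reverse,
    List.mem_reverse] at h
  rcases h with h | h
  · rcases hp v h with e | e
    · exact hav e.symm
    · omega
  · rcases hq v h with e | e
    · exact hbv e.symm
    · omega

variable [Finite V]

lemma IsCliqueTree.adj_parent_of_adj (hG : IsCliqueTree G) {a b q : V} (hab : G.Adj a b)
    (hd : G.dist w b = G.dist w a) (haq : G.Adj a q) (hq : G.dist w q + 1 = G.dist w a) :
    G.Adj b q := by
  obtain ⟨p, hp⟩ := exists_walk_avoiding w hG.1 hab.ne' haq.ne' hd.le (by omega)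
  exact hG.adj_of_walk hab haq p hp (fun e => by subst e; omega)

/-- Two distinct parents of `v` would be adjacent, since they are connected through the root without
`v`, and would share a parent `q`. Then `v` and `q`, neighbours of `a` joined through `b`, would be
adjacent although their depths differ by two. -/
lemma IsCliqueTree.parent_unique (hG : IsCliqueTree G) {v a b : V} (ha : G.Adj v a)
    (hb : G.Adj v b) (hda : G.dist w a + 1 = G.dist w v) (hdb : G.dist w b + 1 = G.dist w v) :
    a = b := by
  by_contra hne
  obtain ⟨p, hp⟩ := exists_walk_avoiding w hG.1 ha.ne' hb.ne' (by omega) (by omega)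
  have hab := hG.adj_of_walk ha hb p hp hne
  have haw : a ≠ w := by
    rintro rfl
    rw [SimpleGraph.dist_self] at hda
    have h0 : G.dist a b = 0 := by omega
    rw [SimpleGraph.dist_eq_one_iff_adj.2 hab] at h0
    omega
  obtain ⟨q, haq, hq⟩ := exists_parent w hG.1 haw
  have hbq := hG.adj_parent_of_adj w hab (by omega) haq hq
  have hvq := hG.adj_of_walk ha.symm haq (.cons hb (.cons hbq .nil))
    (by simpa using ⟨ha.ne', hne, haq.ne⟩) (fun e => by subst e; omega)
  have := dist_le_of_adj w hG.1 hvq.symm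
  omega

end Rooted

end Blocks

/-! ### From clique trees to rooted clique decompositions -/

/-- A clique tree without small blocks decomposes into cliques from any root. -/
theorem IsCliqueTree.exists_cliqueDecomp {V : Type u} [Fintype V] {G : SimpleGraph V}
    (hG : IsCliqueTree G) (h3 : ∀ B : G.Subgraph, IsBlock G B → 3 ≤ B.verts.ncard) (w : V) :
    ∃ (ι : Type u) (_ : Fintype ι) (_ : Nonempty ι) (r : ι → V) (c : V → ι),
      CliqueDecomp G w r c := by
  classical
  choose! par hpar using fun v (hv : v ≠ w) => exists_parent w hG.1 hv
  have hpar_eq : ∀ {v u}, v ≠ w → G.Adj v u → G.dist w u + 1 = G.dist w v → par v = u :=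
    fun hv h hd => hG.parent_unique w (hpar _ hv).1 h (hpar _ hv).2 hd
  have hsame : ∀ {u v}, u ≠ w → v ≠ w → G.Adj u v → G.dist w u = G.dist w v → par u = par v :=
    fun hu hv h hd => (hpar_eq hv (hG.adj_parent_of_adj w h hd.symm (hpar _ hu).1 (hpar _ hu).2)
      (by have := (hpar _ hu).2; omega)).symm
  -- The classes are the non-root parts of the cliques: adjacent vertices with a common parent.
  -- Transitivity holds because `u` and `x` are neighbours of `v` connected, avoiding `v`, through
  -- the common parent.
  let S : Setoid {v : V // v ≠ w} :=
    { r := fun u v => u = v ∨ (par u = par v ∧ G.Adj u v)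
      iseqv :=
        { refl := fun _ => Or.inl rfl
          symm := by
            rintro u v (rfl | ⟨h1, h2⟩)
            · exact Or.inl rfl
            · exact Or.inr ⟨h1.symm, h2.symm⟩
          trans := by
            rintro u v x (rfl | ⟨h1, h2⟩) (rfl | ⟨h3, h4⟩)
            · exact Or.inl rfl
            · exact Or.inr ⟨h3, h4⟩
            · exact Or.inr ⟨h1, h2⟩
            · by_cases hux : u = x
              · exact Or.inl hux
              · have hx := (hpar x x.2).1.symm
                rw [← h3, ← h1] at hx
                refine Or.inr ⟨h1.trans h3, hG.adj_of_walk h2.symm h4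
                  (.cons (hpar u u.2).1 (.cons hx .nil)) ?_ (fun e => hux (Subtype.ext e))⟩
                have := (hpar v v.2).1.ne
                rw [← h1] at this
                simpa using ⟨h2.ne', this, h4.ne⟩ } }
  obtain ⟨v₀, hv₀⟩ : ∃ v₀, v₀ ≠ w := by
    have : 1 < Fintype.card V := by have := hG.three_le_card h3; omega
    have := Fintype.one_lt_card_iff_nontrivial.1 this
    exact exists_ne w
  let c : V → Quotient S := fun v => if h : v ≠ w then Quotient.mk S ⟨v, h⟩
    else Quotient.mk S ⟨v₀, hv₀⟩
  let r : Quotient S → V := Quotient.lift (fun v => par v) (by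
    rintro u v (rfl | ⟨h, -⟩)
    · rfl
    · exact h)
  have hc : ∀ v (hv : v ≠ w), c v = Quotient.mk S ⟨v, hv⟩ := fun v hv => dif_pos hv
  have hr : ∀ v, v ≠ w → r (c v) = par v := fun v hv => by rw [hc v hv]; rfl
  have hceq : ∀ u v, u ≠ w → v ≠ w → (c u = c v ↔ u = v ∨ (par u = par v ∧ G.Adj u v)) := by
    intro u v hu hv
    rw [hc u hu, hc v hv, Quotient.eq]
    exact or_congr_left Subtype.ext_iff
  refine ⟨Quotient S, inferInstance, ⟨Quotient.mk S ⟨v₀, hv₀⟩⟩, r, c, ?_, ?_, ?_⟩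
  · intro u v
    constructor
    · intro h
      refine ⟨h.ne, ?_⟩
      have h1 := dist_le_of_adj w hG.1 h
      have h2 := dist_le_of_adj w hG.1 h.symm
      rcases lt_trichotomy (G.dist w u) (G.dist w v) with hlt | heq | hgt
      · have hv : v ≠ w := by rintro rfl; simp at hlt
        exact Or.inr (Or.inr ⟨hv, (hr v hv).trans (hpar_eq hv h.symm (by omega))⟩)
      · have hiff : u = w ↔ v = w := by
          rw [eq_comm, eq_comm (a := v), ← hG.1.dist_eq_zero_iff (v := u),
            ← hG.1.dist_eq_zero_iff (v := v), heq]
        have hu : u ≠ w := fun e => h.ne (e.trans (hiff.1 e).symm)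
        have hv : v ≠ w := fun e => hu (hiff.2 e)
        exact Or.inl ⟨hu, hv, (hceq u v hu hv).2 (Or.inr ⟨hsame hu hv h heq, h⟩)⟩
      · have hu : u ≠ w := by rintro rfl; simp at hgt
        exact Or.inr (Or.inl ⟨hu, (hr u hu).trans (hpar_eq hu h (by omega))⟩)
    · rintro ⟨hne, ⟨hu, hv, e⟩ | ⟨hu, e⟩ | ⟨hv, e⟩⟩
      · exact (((hceq u v hu hv).1 e).resolve_left hne).2
      · rw [hr u hu] at e; exact e ▸ (hpar u hu).1
      · rw [hr v hv] at e; exact e ▸ (hpar v hv).1.symm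
  · exact ⟨G.dist w, fun v hv => by rw [hr v hv]; have := (hpar v hv).2; omega⟩
  · intro i
    obtain ⟨⟨v, hv⟩, rfl⟩ := Quotient.exists_rep i
    obtain ⟨hadj, hdist⟩ := hpar v hv
    obtain ⟨x, hvx, hpx⟩ := hG.exists_triangle h3 hadj
    have h1 := dist_le_of_adj w hG.1 hvx
    have h2 := dist_le_of_adj w hG.1 hvx.symm
    have h4 := dist_le_of_adj w hG.1 hpx
    -- Otherwise `x`, adjacent to both `v` and its parent, would be a second parent of `v`.
    have hd : G.dist w v = G.dist w x := by
      by_contra hcon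
      exact hpx.ne (hpar_eq hv hvx (by omega))
    have hx : x ≠ w := by
      rintro rfl
      rw [SimpleGraph.dist_self] at hd
      exact hv (hG.1.dist_eq_zero_iff.1 hd).symm
    exact ⟨v, x, hvx.ne, hv, hx, hc v hv, by
      rw [← hc v hv]
      exact (hceq x v hx hv).2 (Or.inr ⟨(hsame hv hx hvx hd).symm, hvx.symm⟩)⟩

/-! ### Stars of cliques and their blocks -/

section Star

variable {ι : Type} {s : ι → ℕ}

lemma cliqueStar_adj {x y : StarVertex s} :
    (cliqueStar s).Adj x y ↔ x ≠ y ∧ ∀ a ∈ x, ∀ b ∈ y, a.1 = b.1 := Iff.rfl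

/-- The index of the clique of a vertex, with the value `i₀` at the common vertex. -/
def starIndex (i₀ : ι) (x : StarVertex s) : ι := x.elim i₀ Sigma.fst

lemma cliqueDecomp_cliqueStar (hs : ∀ i, 3 ≤ s i) (i₀ : ι) :
    CliqueDecomp (cliqueStar s) none (fun _ => none) (starIndex i₀) := by
  refine ⟨?_, ⟨fun x => x.elim 0 (fun _ => 1), ?_⟩, fun i => ?_⟩
  · rintro (_ | a) (_ | b) <;> simp [cliqueStar_adj, starIndex]
  · rintro (_ | a) ha
    · exact absurd rfl ha
    · simp
  · have := hs i
    exact ⟨some ⟨i, ⟨0, by omega⟩⟩, some ⟨i, ⟨1, by omega⟩⟩, by simp, by simp, by simp, rfl, rfl⟩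

/-- The vertex set of the `i`-th clique. -/
def starClique (s : ι → ℕ) (i : ι) : Set (StarVertex s) := {x | ∀ a ∈ x, a.1 = i}

lemma adj_of_mem_starClique {i : ι} {x y : StarVertex s} (hx : x ∈ starClique s i)
    (hy : y ∈ starClique s i) (hxy : x ≠ y) : (cliqueStar s).Adj x y :=
  ⟨hxy, fun a ha b hb => (hx a ha).trans (hy b hb).symm⟩

lemma eq_of_preconnected {W κ : Type*} {K : SimpleGraph W} (hK : K.Preconnected) (f : W → κ)
    (hf : ∀ a b, K.Adj a b → f a = f b) (a b : W) : f a = f b := by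
  obtain ⟨p⟩ := hK a b
  induction p with
  | nil => rfl
  | cons h _ ih => exact (hf _ _ h).trans ih

/-- Away from the common vertex the clique index is constant along edges. A subgraph meeting two
cliques would be disconnected by deleting the common vertex, or already be disconnected without it.
-/
lemma subset_starClique_of_hasNoCut [Nonempty ι] {H : (cliqueStar s).Subgraph}
    (hH : HasNoCut H) : ∃ i, H.verts ⊆ starClique s i := by
  by_contra! hcon
  have hex : ∀ i, ∃ a : Σ i : ι, Fin (s i - 1), some a ∈ H.verts ∧ a.1 ≠ i := by
    intro i
    obtain ⟨x, hx, hx'⟩ := Set.not_subset.1 (hcon i)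
    simp only [starClique, Set.mem_ofPred_eq, not_forall] at hx'
    obtain ⟨a, ha, hai⟩ := hx'
    exact ⟨a, by rwa [← Option.mem_def.1 ha], hai⟩
  obtain ⟨i₀⟩ := ‹Nonempty ι›
  obtain ⟨a, ha, -⟩ := hex i₀
  obtain ⟨b, hb, hba⟩ := hex a.1
  have hidx : ∀ x y : StarVertex s, x ≠ none → y ≠ none → H.Adj x y →
      starIndex i₀ x = starIndex i₀ y := by
    rintro (_ | x) (_ | y) hx hy hxy
    · rfl
    · exact absurd rfl hx
    · exact absurd rfl hy
    · exact (H.adj_sub hxy).2 x rfl y rfl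
  apply hba
  by_cases hn : (none : StarVertex s) ∈ H.verts
  · have h1 := not_not.1 (hH.2 ⟨none, hn⟩)
    exact eq_of_preconnected h1 (fun x => starIndex i₀ x.1.1)
      (fun x y hxy => hidx _ _ (fun e => x.2 (Subtype.ext e)) (fun e => y.2 (Subtype.ext e)) hxy)
      ⟨⟨some b, hb⟩, fun e => by simpa using congrArg Subtype.val e⟩
      ⟨⟨some a, ha⟩, fun e => by simpa using congrArg Subtype.val e⟩
  · have h1 := hH.1.coe.preconnected
    exact eq_of_preconnected h1 (fun x => starIndex i₀ x.1)
      (fun x y hxy => hidx _ _ (fun e => hn (e ▸ x.2)) (fun e => hn (e ▸ y.2)) hxy)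
      ⟨some b, hb⟩ ⟨some a, ha⟩

lemma IsBlock.eq_induce_starClique [Nonempty ι] {B : (cliqueStar s).Subgraph}
    (hB : IsBlock (cliqueStar s) B) :
    ∃ i, B = (⊤ : (cliqueStar s).Subgraph).induce (starClique s i) := by
  obtain ⟨i, hi⟩ := subset_starClique_of_hasNoCut hB.1
  refine ⟨i, le_antisymm ?_ (hB.2 ?_ ?_)⟩
  · exact (SimpleGraph.Subgraph.le_induce_top_verts).trans
      (SimpleGraph.Subgraph.induce_mono_right hi)
  · exact hasNoCut_induce_of_clique ⟨none, by simp [starClique]⟩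
      (fun a ha b hb hab => adj_of_mem_starClique ha hb hab)
  · exact (SimpleGraph.Subgraph.le_induce_top_verts).trans
      (SimpleGraph.Subgraph.induce_mono_right hi)

lemma isCliqueTree_cliqueStar [Nonempty ι] : IsCliqueTree (cliqueStar s) := by
  constructor
  · rw [SimpleGraph.connected_iff_exists_forall_reachable]
    refine ⟨none, fun x => ?_⟩
    by_cases hx : none = x
    · rw [hx]
    · exact SimpleGraph.Adj.reachable ⟨hx, by simp⟩
  · intro B hB
    obtain ⟨i, rfl⟩ := hB.eq_induce_starClique
    ext ⟨a, ha⟩ ⟨b, hb⟩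
    simp only [SimpleGraph.top_adj]
    refine ⟨fun h => h.ne, fun h => ⟨ha, hb, adj_of_mem_starClique ha hb fun e => h ?_⟩⟩
    exact Subtype.ext e

lemma three_le_ncard_block [Finite ι] [Nonempty ι] (hs : ∀ i, 3 ≤ s i)
    {B : (cliqueStar s).Subgraph} (hB : IsBlock (cliqueStar s) B) : 3 ≤ B.verts.ncard := by
  obtain ⟨i, rfl⟩ := hB.eq_induce_starClique
  have := hs i
  have hsub : ({none, some ⟨i, ⟨0, by omega⟩⟩, some ⟨i, ⟨1, by omega⟩⟩} : Set (StarVertex s)) ⊆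
      starClique s i := by
    rintro x (rfl | rfl | rfl) <;> simp [starClique]
  refine le_trans (le_of_eq ?_) (Set.ncard_le_ncard hsub (Set.toFinite _))
  rw [Set.ncard_eq_three.2 ⟨_, _, _, by simp, by simp, by simp, rfl⟩]

end Star

/-! ### Merging cliques into a copy of the extremal graph -/

lemma CliqueDecomp.comap {V W ι : Type*} {H : SimpleGraph W} {w : W} {r : ι → W} {c : W → ι}
    (h : CliqueDecomp H w r c) (e : V ≃ W) :
    CliqueDecomp (H.comap e) (e.symm w) (fun i => e.symm (r i)) (fun v => c (e v)) := by
  obtain ⟨d, hd⟩ := h.depth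
  have hne : ∀ v, v ≠ e.symm w ↔ e v ≠ w := fun v => not_congr e.eq_symm_apply
  refine ⟨fun u v => ?_, ⟨fun v => d (e v), fun v hv => ?_⟩, fun i => ?_⟩
  · rw [SimpleGraph.comap_adj, h.adj_iff]
    simp only [hne, e.symm_apply_eq, e.injective.ne_iff]
  · simpa using hd _ ((hne v).1 hv)
  · obtain ⟨a, b, hab, ha, hb, hca, hcb⟩ := h.two_le i
    exact ⟨e.symm a, e.symm b, by simpa using hab, by simpa using ha, by simpa using hb,
      by simpa using hca, by simpa using hcb⟩

/-- A labelling of the vertices `v ≠ w` whose fibres have the right sizes comes from a bijection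
with the vertices of a star of cliques. -/
lemma exists_equiv_starVertex {V : Type*} [Fintype V] [DecidableEq V] {ι : Type} [DecidableEq ι]
    {s : ι → ℕ} (w : V) (f : {v : V // v ≠ w} → ι)
    (hf : ∀ i, Fintype.card {v // f v = i} = s i - 1) (i₀ : ι) :
    ∃ e : V ≃ StarVertex s, e w = none ∧ ∀ v (hv : v ≠ w), starIndex i₀ (e v) = f ⟨v, hv⟩ := by
  let e₁ : {v : V // v ≠ w} ≃ Σ i : ι, Fin (s i - 1) :=
    (Equiv.sigmaFiberEquiv f).symm.trans
      (Equiv.sigmaCongrRight fun i => Fintype.equivFinOfCardEq (hf i))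
  refine ⟨(Equiv.optionSubtypeNe w).symm.trans e₁.optionCongr, by simp, fun v hv => ?_⟩
  simp only [Equiv.trans_apply, Equiv.optionSubtypeNe_symm_of_ne hv]
  rfl

/-- Two vertices of each clique but the `i₀`-th keep their clique and all others move to the
`i₀`-th. -/
lemma exists_merge {V : Type*} [Fintype V] {ι : Type*} [Fintype ι] {G : SimpleGraph V} {w : V}
    {r : ι → V} {c : V → ι} (h : CliqueDecomp G w r c) (i₀ : ι) {n k : ℕ}
    (hn : Fintype.card V = n) (hk : k + Fintype.card ι = n) :
    ∃ (τ : Fin (n - k - 1) ≃ {i : ι // i ≠ i₀}) (e : V ≃ StarVertex (extremalSizes n k)),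
      e w = none ∧
      (∀ v, v ≠ w → ∀ j, starIndex none (e v) = some j → c v = τ j) ∧
      ∀ v, v ≠ w → c v = i₀ → starIndex none (e v) = none := by
  classical
  choose p q hpq hp hq hcp hcq using h.two_le
  have hcard : Fintype.card {i : ι // i ≠ i₀} = n - k - 1 := by
    rw [Fintype.card_subtype_compl, Fintype.card_subtype_eq]; omega
  let τ : Fin (n - k - 1) ≃ {i : ι // i ≠ i₀} := (Fintype.equivFinOfCardEq hcard).symm
  let f : {v : V // v ≠ w} → Option (Fin (n - k - 1)) := fun v =>
    if hv : c v ≠ i₀ ∧ (v.1 = p (c v) ∨ v.1 = q (c v)) then some (τ.symm ⟨c v, hv.1⟩) else none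
  have hfsome : ∀ v j, f v = some j ↔ v.1 = p (τ j) ∨ v.1 = q (τ j) := by
    intro v j
    constructor
    · intro hv
      by_cases hcv : c v ≠ i₀ ∧ (v.1 = p (c v) ∨ v.1 = q (c v))
      · simp only [f, dif_pos hcv, Option.some.injEq] at hv
        rw [← hv, Equiv.apply_symm_apply]
        exact hcv.2
      · simp only [f, dif_neg hcv] at hv
        exact absurd hv (by simp)
    · intro hv
      have hcv : c v = τ j := by
        rcases hv with e | e <;> rw [e] <;> [exact hcp _; exact hcq _]
      have h1 : c v ≠ i₀ ∧ (v.1 = p (c v) ∨ v.1 = q (c v)) := by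
        rw [hcv]; exact ⟨(τ j).2, hv⟩
      simp only [f, dif_pos h1, Option.some.injEq]
      rw [Equiv.symm_apply_eq]
      exact Subtype.ext hcv
  have hfiber : ∀ j, Fintype.card {v // f v = some j} = 2 := by
    intro j
    rw [Fintype.card_subtype]
    have : ({v | f v = some j} : Finset {v : V // v ≠ w}) =
        {⟨p (τ j), hp _⟩, ⟨q (τ j), hq _⟩} := by
      ext v
      simp [hfsome, Subtype.ext_iff]
    rw [this, card_pair]
    exact fun e => hpq _ (congrArg Subtype.val e)
  have htotal : Fintype.card {v : V // v ≠ w} = n - 1 := by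
    rw [Fintype.card_subtype_compl, Fintype.card_subtype_eq, hn]
  have hsum : Fintype.card {v : V // v ≠ w} = ∑ o, Fintype.card {v // f v = o} := by
    rw [← Fintype.card_sigma]
    exact Fintype.card_congr (Equiv.sigmaFiberEquiv f).symm
  have hge := h.card_add_card_le
  have hpos : 0 < Fintype.card ι := Fintype.card_pos_iff.2 ⟨i₀⟩
  -- The fibre over `none` has the n - 1 - 2(n - k - 1) = (2k + 2 - n) - 1 remaining vertices.
  obtain ⟨e, hew, he⟩ := exists_equiv_starVertex (s := extremalSizes n k) w f (by
    rintro (_ | j)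
    · rw [Fintype.sum_option] at hsum
      simp only [hfiber, sum_const, card_univ, Fintype.card_fin, smul_eq_mul] at hsum
      simp only [extremalSizes]
      omega
    · rw [hfiber]; rfl) none
  refine ⟨τ, e, hew, fun v hv j hj => ?_, fun v hv hcv => ?_⟩
  · rw [he v hv, hfsome] at hj
    rcases hj with e | e
    · exact (congrArg c e).trans (hcp _)
    · exact (congrArg c e).trans (hcq _)
  · rw [he v hv]
    have h1 : ¬ (c v ≠ i₀ ∧ (v = p (c v) ∨ v = q (c v))) := fun hcon => hcon.1 hcv
    simp only [f, dif_neg h1]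

/-- The bound `hnk` is that of `card_add_card_le` for n - k cliques, and says exactly that 2k + 2 -
n ≥ 3. -/
lemma three_le_extremalSizes {n k : ℕ} (hnk : 2 * (n - k) + 1 ≤ n) (hk : k ≤ n)
    (i : Option (Fin (n - k - 1))) : 3 ≤ extremalSizes n k i := by
  rcases i with _ | i <;> simp only [extremalSizes]
  · omega
  · exact le_rfl

lemma inClass_extremalGraph {n k : ℕ} (hnk : 2 * (n - k) + 1 ≤ n) (hk : k < n) :
    InClass n k (extremalGraph n k) := by
  have hs := three_le_extremalSizes hnk hk.le
  have hcard : Fintype.card (StarVertex (extremalSizes n k)) = n := by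
    rw [Fintype.card_option, Fintype.card_sigma]
    simp only [Fintype.card_fin, Fintype.sum_option]
    simp only [extremalSizes, sum_const, card_univ, Fintype.card_fin, smul_eq_mul]
    omega
  refine ⟨hcard, isCliqueTree_cliqueStar, fun B hB => three_le_ncard_block hs hB, ?_⟩
  have h := (cliqueDecomp_cliqueStar hs none).zeroForcingNumber_add_card
  rw [hcard, Fintype.card_option, Fintype.card_fin] at h
  change zeroForcingNumber (cliqueStar (extremalSizes n k)) = k
  omega

end CliqueTree

/-! ### The main theorem -/

open CliqueTree in
theorem mainTheorem1 {V : Type*} [Fintype V] (n k : ℕ) (G : SimpleGraph V)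
    (hG : CliqueTree.InClass n k G) :
    CliqueTree.InClass n k (CliqueTree.extremalGraph n k) ∧
    CliqueTree.rho G ≤ CliqueTree.rho (CliqueTree.extremalGraph n k) ∧
    (CliqueTree.rho G = CliqueTree.rho (CliqueTree.extremalGraph n k) ↔
      Nonempty (G ≃g CliqueTree.extremalGraph n k)) := by
  obtain ⟨hn, hT, h3, hZ⟩ := hG
  have := hT.1.nonempty
  obtain ⟨s, x, hs, hrho, hx, hform, heig⟩ := exists_pos_eigenvector G hT.1
  obtain ⟨w, hw⟩ := Finite.exists_max x
  obtain ⟨ι, _, _, r, c, h⟩ := hT.exists_cliqueDecomp h3 w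
  obtain ⟨i₀, hi₀⟩ := Finite.exists_max (CliqueDecomp.weight w c x)
  have hk := h.zeroForcingNumber_add_card
  rw [hZ, hn] at hk
  have hge := h.card_add_card_le
  have hpos : 0 < Fintype.card ι := Fintype.card_pos
  have hsizes := three_le_extremalSizes (n := n) (k := k) (by omega) (by omega)
  obtain ⟨τ, e, hew, hτ, hmerge⟩ := exists_merge h i₀ hn hk
  have h' := (cliqueDecomp_cliqueStar hsizes none).comap e
  rw [← hew, e.symm_apply_apply] at h'
  set G' : SimpleGraph V := (cliqueStar (extremalSizes n k)).comap e with hG'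
  let φ : G' ≃g extremalGraph n k := ⟨e, Iff.rfl⟩
  have hle := h.adjForm_le h' τ hτ (fun v => (hx v).le) hw hi₀
  obtain ⟨s', hs', hrho', hray, heig', -⟩ := exists_rho_eq G'
  have hsq : 0 < ∑ v, x v ^ 2 := Finset.sum_pos (fun v _ => pow_pos (hx v) 2) Finset.univ_nonempty
  have hss : s ≤ s' := by
    have := hray x
    rw [hform] at hle
    exact le_of_mul_le_mul_right (hle.trans this) hsq
  rw [← rho_iso φ]
  refine ⟨inClass_extremalGraph (by omega) (by omega), ?_, fun heq => ?_, fun ⟨ψ⟩ => ?_⟩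
  · rw [hrho, hrho']
    exact ENNReal.ofReal_le_ofReal hss
  · rw [hrho, hrho', ENNReal.ofReal_eq_ofReal_iff hs hs'] at heq
    subst heq
    -- With equal radii, `x` attains the Rayleigh bound of `G'` and so is an eigenvector of `G'`
    -- too.
    have hx' := heig' x (le_antisymm (hray x) (hform ▸ hle))
    have hw' : ∀ v, v ≠ w → G'.Adj w v := fun v hv =>
      (h'.adj_iff _ _).2 ⟨hv.symm, Or.inr (Or.inr ⟨hv, rfl⟩)⟩
    have hwG : ∀ v, v ≠ w → G.Adj w v := fun v hv =>
      adj_of_eigenvector hx (heig w) (hx' w) (fun u hu => hw' u hu.ne') (hw' v hv)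
    have hcw : ∀ u v, u ≠ w → v ≠ w → (G.Adj u v ↔ u ≠ v ∧ c u = c v) := by
      intro u v hu hv
      have hr : ∀ y, y ≠ w → r (c y) = w := fun y hy => by
        rcases ((h.adj_iff _ _).1 (hwG y hy)).2 with ⟨e, -⟩ | ⟨e, -⟩ | ⟨-, e⟩
        · exact absurd rfl e
        · exact absurd rfl e
        · exact e
      rw [h.adj_iff, hr u hu, hr v hv]
      simp [hu, hv, hu.symm, hv.symm]
    have hcw' : ∀ u v, u ≠ w → v ≠ w → (G'.Adj u v ↔ u ≠ v ∧
        starIndex none (e u) = starIndex none (e v)) := by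
      intro u v hu hv
      rw [h'.adj_iff]
      simp [hu, hv, hu.symm, hv.symm]
    -- The clique `i₀` only gains vertices, so the neighbourhood of `u₀` in `G` lies in that in
    -- `G'`; equality means that nothing was moved into it.
    obtain ⟨u₀, -, -, hu₀, -, hcu₀, -⟩ := h.two_le i₀
    have hu₀' := hmerge u₀ hu₀ hcu₀
    have hnone : ∀ v, v ≠ w → (starIndex none (e v) = none ↔ c v = i₀) := by
      refine fun v hv => ⟨fun hv' => ?_, hmerge v hv⟩
      by_cases huv : u₀ = v
      · rw [← huv, hcu₀]
      have hadj := adj_of_eigenvector hx (heig u₀) (hx' u₀) (fun y hy => ?_)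
        ((hcw' u₀ v hu₀ hv).2 ⟨huv, by rw [hu₀', hv']⟩)
      · rw [← ((hcw u₀ v hu₀ hv).1 hadj).2, hcu₀]
      · by_cases hyw : y = w
        · rw [hyw]; exact (hw' u₀ hu₀).symm
        · have h1 := (hcw u₀ y hu₀ hyw).1 hy
          exact (hcw' u₀ y hu₀ hyw).2 ⟨h1.1, by rw [hu₀', hmerge y hyw (by rw [← h1.2, hcu₀])]⟩
    have hsome : ∀ v, v ≠ w → ∀ j, starIndex none (e v) = some j ↔ c v = τ j := by
      refine fun v hv j => ⟨hτ v hv j, fun hj => ?_⟩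
      rcases hv' : starIndex none (e v) with _ | j'
      · rw [hnone v hv, hj] at hv'
        exact absurd hv' (τ j).2
      · have := hτ v hv j' hv'
        rw [hj] at this
        rw [τ.injective (Subtype.ext this)]
    have hGG' : G = G' := by
      ext u v
      by_cases hu : u = w
      · subst hu
        by_cases hv : v = u
        · simp [hv]
        · simp [hwG v hv, hw' v hv]
      by_cases hv : v = w
      · subst hv
        simp [(hwG u hu).symm, (hw' u hu).symm]
      rw [hcw u v hu hv, hcw' u v hu hv]
      refine and_congr_right fun _ => ?_
      rcases hv' : starIndex none (e v) with _ | j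
      · rw [hnone u hu, (hnone v hv).1 hv']
      · rw [hsome u hu, (hsome v hv j).1 hv']
    rw [hGG']
    exact ⟨φ⟩
  · rw [rho_iso ψ, rho_iso φ]
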